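/- Theorem (weak convergence of the CCA estimator for fixed $p$). Let $G$ be a finite simple graph with $p$ vertices, $\sigma$ an ordering of its vertices, and $G_\sigma$ the resulting ordered graph on $\{1,\dots,p\}$ with edge set $E_\sigma$. Let $\mathbb{P}_{G_\sigma}$ be the set of positive definite $p\times p$ matrices whose $(i,j)$ entry is $0$ whenever $i\neq j$ and $(i,j)\notin E_\sigma$. The filled graph $G_\sigma^D$, with edge set $E_\sigma^D$, is the smallest graph on $\{1,\dots,p\}$ that is chordal, has the natural order as a perfect elimination scheme (if $u>v>w$ and $(u,w),(v,w)$ are edges, then $(u,v)$ is an edge), and satisfies $L_{ij}=0$ for all $i>j$ with $(i,j)$ not an edge of it, for the lower triangular Cholesky factor $L$ of every matrix in $\mathbb{P}_{G_\sigma}$. Given a sample covariance matrix $S$, the CCA estimator $\widehat\Omega$ is computed as follows. For each $j$ let $N_j=\{k>j:(k,j)\in E_\sigma^D\}$, $S^{>j}=(S_{kl})_{k,l\in N_j}$, $S^{>}_{\cdot j}=(S_{kj})_{k\in N_j}$ and $r_j=S_{jj}-(S^{>}_{\cdot j})^T(S^{>j})^{-1}S^{>}_{\cdot j}$. Let $\widehat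 L^D$ be the lower triangular matrix with $\widehat L^D_{jj}=r_j^{-1/2}$, with $(\widehat L^D_{kj})_{k\in N_j}=-r_j^{-1/2}(S^{>j})^{-1}S^{>}_{\cdot j}$, and with all other entries $0$. Start from $\widehat L=\widehat L^D$; for $i=2,\dots,p$ and, for each $i$, for $j=1,\dots,i-1$ in this order, if $(i,j)\notin E_\sigma$ set $\widehat L_{ij}\leftarrow-\big(\sum_{k=1}^{j-1}\widehat L_{ik}\widehat L_{jk}\big)/\widehat L_{jj}$. Finally $\widehat\Omega=\widehat L\widehat L^T$. (If $S$ does not allow one of these operations, the conventions $x/0=0$, $A^{-1}=0$ for singular $A$, and $\sqrt{x}=0$ for $x<0$ are used.) Let $Y_1,Y_2,\dots$ be i.i.d. random vectors in $\mathbb{R}^p$ ($p$ fixed) with distribution $F$, whose covariance matrix is $\bar\Omega^{-1}$ for some $\bar\Omega\in\mathbb{P}_{G_\sigma}$, and assume that $$\int_{\mathbb{R}^p}\prod_{i=1}^p|x_i|^{a_i}\,dF(x)<\infty$$ for all non-negative integers $a_1,\dots,a_p$ with $\sum_{i=1}^p a_i=4$. Let $S=S_n$ be the sample covariance matrix of $Y_1,\dots,Y_n$: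 either $\frac1n\sum_{t\le n}(Y_t-\bar Y)(Y_t-\bar Y)^T$, or the same with $\frac1{n-1}$ in place of $\frac1n$, or, if $F$ has mean zero, $\frac1n\sum_{t\le n}Y_tY_t^T$. Let $\widehat\Omega=\widehat\Omega_n$ be the CCA estimator computed from $S_n$. Then $\widehat\Omega_n$ is $\sqrt n$-consistent for $\bar\Omega$, i.e. for every $\varepsilon>0$ there is $M$ such that $P\big(\max_{i,j}\sqrt n\,|(\widehat\Omega_n)_{ij}-\bar\Omega_{ij}|>M\big)\le\varepsilon$ for all $n$; and, as $n\to\infty$, $\sqrt n(\widehat\Omega_n-\bar\Omega)$ converges in distribution to a (possibly degenerate) centred Gaussian random $p\times p$ matrix. -/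

import Mathlib

open MeasureTheory ProbabilityTheory Filter Matrix

noncomputable section

namespace CCA

/-! ### Ordered graphs and matrix spaces -/

/-- The ordered graph `G_σ` on the vertex set `V_p = Fin p`, for an ordering `σ` of the vertices
of `G`: its edges are the pairs `(σ u, σ v)` with `(u, v)` an edge of `G`. -/
def orderedGraph {V : Type*} {p : ℕ} (G : SimpleGraph V) (σ : V ≃ Fin p) : SimpleGraph (Fin p) :=
  G.map σ.toEmbedding

/-- `ℙ_H`: positive definite matrices whose off-diagonal entries vanish outside the edges of the
ordered graph `H`. -/
def posDefSpace {p : ℕ} (H : SimpleGraph (Fin p)) : Set (Matrix (Fin p) (Fin p) ℝ) :=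
  {A | A.PosDef ∧ ∀ i j, i ≠ j → ¬ H.Adj i j → A i j = 0}

/-- `𝕃⁺`: lower triangular matrices with positive diagonal entries. -/
def lowerPos (p : ℕ) : Set (Matrix (Fin p) (Fin p) ℝ) :=
  {L | (∀ i j, i < j → L i j = 0) ∧ ∀ i, 0 < L i i}

/-- `𝕃_H`: the Cholesky factors of the matrices in `ℙ_H`. -/
def cholSpace {p : ℕ} (H : SimpleGraph (Fin p)) : Set (Matrix (Fin p) (Fin p) ℝ) :=
  {L | L ∈ lowerPos p ∧ L * Lᵀ ∈ posDefSpace H}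

/-! ### Filled graphs -/

/-- No induced cycle of length at least four. -/
def IsDecomposable {V : Type*} (D : SimpleGraph V) : Prop :=
  ∀ m : ℕ, 4 ≤ m → IsEmpty (SimpleGraph.cycleGraph m ↪g D)

/-- The natural order of `Fin p` is a perfect vertex elimination scheme for `D`. -/
def IsPerfectElimination {p : ℕ} (D : SimpleGraph (Fin p)) : Prop :=
  ∀ u v w : Fin p, w < v → v < u → D.Adj u w → D.Adj v w → D.Adj u v

/-- `D` is an ordered decomposable graph whose edges carry all the nonzero entries below the
diagonal of the Cholesky factors of the matrices in `ℙ_H`. -/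
structure IsFillCover {p : ℕ} (H D : SimpleGraph (Fin p)) : Prop where
  decomposable : IsDecomposable D
  perfect : IsPerfectElimination D
  chol_zero : ∀ L ∈ cholSpace H, ∀ i j, j < i → ¬ D.Adj i j → L i j = 0

/-- The filled graph of the ordered graph `H`: the smallest fill cover of `H`
(see `isLeast_filledGraph`). -/
def filledGraph {p : ℕ} (H : SimpleGraph (Fin p)) : SimpleGraph (Fin p) :=
  sInf {D | IsFillCover H D}

open Fin.CommRing in
/-- A graph with a perfect vertex elimination scheme has no induced cycle of length `≥ 4`. -/
theorem IsPerfectElimination.isDecomposable {p : ℕ} {D : SimpleGraph (Fin p)}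
    (h : IsPerfectElimination D) : IsDecomposable D := by
  intro m hm
  refine ⟨fun f => ?_⟩
  obtain ⟨n, rfl⟩ : ∃ n, m = n + 4 := ⟨m - 4, by omega⟩
  obtain ⟨i, -, hi⟩ := Finset.exists_min_image (Finset.univ : Finset (Fin (n + 4)))
    (fun i => f i) ⟨0, Finset.mem_univ _⟩
  have h1 : (SimpleGraph.cycleGraph (n + 4)).Adj (i + 1) i := by
    rw [SimpleGraph.cycleGraph_adj]; left; ring
  have h2 : (SimpleGraph.cycleGraph (n + 4)).Adj (i - 1) i := by
    rw [SimpleGraph.cycleGraph_adj]; right; ring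
  have e1 : (2 : Fin (n + 4)) ≠ 1 := by
    intro e; have := congrArg Fin.val e
    simp [Nat.mod_eq_of_lt] at this
  have e2 : (-2 : Fin (n + 4)) ≠ 1 := by
    intro e
    have e3 : (3 : Fin (n + 4)) = 0 := by
      calc (3 : Fin (n + 4)) = 1 - (-2) := by ring
        _ = 0 := by rw [e]; ring
    have := congrArg Fin.val e3
    simp [Nat.mod_eq_of_lt] at this
  have e0 : (2 : Fin (n + 4)) ≠ 0 := by
    intro e; have := congrArg Fin.val e
    simp [Nat.mod_eq_of_lt] at this
  have h3 : ¬ (SimpleGraph.cycleGraph (n + 4)).Adj (i + 1) (i - 1) := by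
    rw [SimpleGraph.cycleGraph_adj]
    rintro (e | e)
    · exact e1 (by rw [← e]; ring)
    · exact e2 (by rw [← e]; ring)
  have h4 : i + 1 ≠ i - 1 := by
    intro e
    apply e0
    calc (2 : Fin (n + 4)) = (i + 1) - (i - 1) := by ring
      _ = 0 := by rw [e]; ring
  have l1 : f i < f (i + 1) :=
    lt_of_le_of_ne (hi _ (Finset.mem_univ _)) fun e => h1.ne (f.injective e).symm
  have l2 : f i < f (i - 1) :=
    lt_of_le_of_ne (hi _ (Finset.mem_univ _)) fun e => h2.ne (f.injective e).symm
  have a1 : D.Adj (f (i + 1)) (f i) := f.map_adj_iff.2 h1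
  have a2 : D.Adj (f (i - 1)) (f i) := f.map_adj_iff.2 h2
  rcases lt_trichotomy (f (i + 1)) (f (i - 1)) with l | l | l
  · exact h3 (f.map_adj_iff.1 (h _ _ _ l1 l a2 a1).symm)
  · exact h4 (f.injective l)
  · exact h3 (f.map_adj_iff.1 (h _ _ _ l2 l a1 a2))

/-- The filled graph is a fill cover, and its edges are edges of every fill cover. -/
theorem isLeast_filledGraph {p : ℕ} (H : SimpleGraph (Fin p)) :
    IsLeast {D | IsFillCover H D} (filledGraph H) := by
  have hp : IsPerfectElimination (filledGraph H) := by
    intro u v w hwv hvu huw hvw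
    simp only [filledGraph, SimpleGraph.sInf_adj] at huw hvw ⊢
    exact ⟨fun D hD => hD.perfect u v w hwv hvu (huw.1 D hD) (hvw.1 D hD), hvu.ne'⟩
  refine ⟨⟨hp.isDecomposable, hp, ?_⟩, fun D hD => sInf_le hD⟩
  intro L hL i j hij hadj
  simp only [filledGraph, SimpleGraph.sInf_adj] at hadj
  by_contra hne
  exact hadj ⟨fun D hD => by_contra fun hD' => hne (hD.chol_zero L hL i j hij hD'), hij.ne'⟩

/-! ### The estimator -/

/-- The later neighbours of `j` in `D`. -/
abbrev LaterNbr {p : ℕ} (D : SimpleGraph (Fin p)) (j : Fin p) : Type :=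
  {k : Fin p // j < k ∧ D.Adj k j}

/-- `S^{>j}`: the block of `S` on the later neighbours of `j`. -/
def blockGt {p : ℕ} (D : SimpleGraph (Fin p)) (S : Matrix (Fin p) (Fin p) ℝ) (j : Fin p) :
    Matrix (LaterNbr D j) (LaterNbr D j) ℝ :=
  Matrix.of fun k l => S k.1 l.1

/-- `S^{>}_{·j}`: the part of the `j`-th column of `S` on the later neighbours of `j`. -/
def colGt {p : ℕ} (D : SimpleGraph (Fin p)) (S : Matrix (Fin p) (Fin p) ℝ) (j : Fin p) :
    LaterNbr D j → ℝ :=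
  fun k => S k.1 j

open Classical in
/-- `(S^{>j})⁻¹ S^{>}_{·j}`. -/
def regCoef {p : ℕ} (D : SimpleGraph (Fin p)) (S : Matrix (Fin p) (Fin p) ℝ) (j : Fin p) :
    LaterNbr D j → ℝ :=
  (blockGt D S j)⁻¹ *ᵥ colGt D S j

open Classical in
/-- `S_{jj} - (S^{>}_{·j})ᵀ (S^{>j})⁻¹ S^{>}_{·j}`. -/
def residVar {p : ℕ} (D : SimpleGraph (Fin p)) (S : Matrix (Fin p) (Fin p) ℝ) (j : Fin p) : ℝ :=
  S j j - colGt D S j ⬝ᵥ regCoef D S j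

open Classical in
/-- Step I: the intermediate Cholesky factor `L̂ᴰ` computed from `S` by its closed form. -/
def interChol {p : ℕ} (D : SimpleGraph (Fin p)) (S : Matrix (Fin p) (Fin p) ℝ) :
    Matrix (Fin p) (Fin p) ℝ :=
  Matrix.of fun i j =>
    if i = j then 1 / √(residVar D S j)
    else if h : j < i ∧ D.Adj i j then -(regCoef D S j ⟨i, h⟩) / √(residVar D S j)
    else 0

open Classical in
/-- The body of the double loop of Step II: if `(i, j)` is not an edge of `H`, assign
`L_{ij} ← -(∑_{k < j} L_{ik} L_{jk}) / L_{jj}`. -/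
def updateEntry {p : ℕ} (H : SimpleGraph (Fin p)) (i j : Fin p)
    (L : Matrix (Fin p) (Fin p) ℝ) : Matrix (Fin p) (Fin p) ℝ :=
  if H.Adj i j then L
  else Matrix.of fun a b =>
    if a = i ∧ b = j then -(∑ k ∈ Finset.univ.filter (fun k => k < j), L i k * L j k) / L j j
    else L a b

/-- Step II: the double loop, `i` running upwards over all rows and, for each `i`, `j` running
upwards over the indices smaller than `i` (the first row has none). -/
def stepTwo {p : ℕ} (H : SimpleGraph (Fin p)) (L : Matrix (Fin p) (Fin p) ℝ) :
    Matrix (Fin p) (Fin p) ℝ :=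
  (List.finRange p).foldl
    (fun L i => ((List.finRange p).filter (fun j => decide (j < i))).foldl
      (fun L j => updateEntry H i j L) L) L

/-- The CCA Cholesky factor `L̂` computed from `S`. -/
def ccaChol {p : ℕ} (H : SimpleGraph (Fin p)) (S : Matrix (Fin p) (Fin p) ℝ) :
    Matrix (Fin p) (Fin p) ℝ :=
  stepTwo H (interChol (filledGraph H) S)

/-- The CCA estimator `Ω̂ = L̂ L̂ᵀ` computed from `S`. -/
def ccaEstimator {p : ℕ} (H : SimpleGraph (Fin p)) (S : Matrix (Fin p) (Fin p) ℝ) :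
    Matrix (Fin p) (Fin p) ℝ :=
  ccaChol H S * (ccaChol H S)ᵀ

/-! ### Covariance matrices -/

/-- The covariance matrix of a distribution on `ℝᵖ`. -/
def covarianceMatrix {p : ℕ} (F : Measure (Fin p → ℝ)) : Matrix (Fin p) (Fin p) ℝ :=
  Matrix.of fun i j => cov[fun x => x i, fun x => x j; F]

/-- The sample mean of `y 0, …, y (n - 1)`. -/
def sampleMean {p : ℕ} (n : ℕ) (y : ℕ → Fin p → ℝ) : Fin p → ℝ :=
  fun i => (n : ℝ)⁻¹ * ∑ t ∈ Finset.range n, y t i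

/-- The usual normalizations of the sample covariance matrix. -/
inductive SampleCovKind
  /-- products about zero, divided by `n` (for distributions with mean zero) -/
  | aboutZero
  /-- products about the sample mean, divided by `n` -/
  | aboutMean
  /-- products about the sample mean, divided by `n - 1` -/
  | aboutMeanUnbiased

/-- The sample covariance matrix of `y 0, …, y (n - 1)`. -/
def sampleCov {p : ℕ} (c : SampleCovKind) (n : ℕ) (y : ℕ → Fin p → ℝ) :
    Matrix (Fin p) (Fin p) ℝ :=
  match c with
  | .aboutZero => Matrix.of fun i j => (n : ℝ)⁻¹ * ∑ t ∈ Finset.range n, y t i * y t j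
  | .aboutMean => Matrix.of fun i j =>
      (n : ℝ)⁻¹ * ∑ t ∈ Finset.range n,
        (y t i - sampleMean n y i) * (y t j - sampleMean n y j)
  | .aboutMeanUnbiased => Matrix.of fun i j =>
      ((n : ℝ) - 1)⁻¹ * ∑ t ∈ Finset.range n,
        (y t i - sampleMean n y i) * (y t j - sampleMean n y j)

end CCA

end

/-!
The CCA estimator is `g(S)` for a map `g` which is measurable, and differentiable at every
positive definite `S`: Step I divides only by the determinants of the blocks `S^{>j}` and by the
square roots of the Schur complements `r_j`, and Step II only by the diagonal entries of `L̂`,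
which it never changes. Moreover `g(A⁻¹) = A` for `A ∈ ℙ_H`: at `S = A⁻¹`, Step I recovers the
Cholesky factor `L` of `A` because `S L = (L⁻¹)ᵀ` is upper triangular, and Step II fixes `L`
because its assignments solve `(L Lᵀ)_{ij} = 0`. By the delta method it then suffices that `S_n`
is asymptotically normal. This is the central limit theorem for the vectors
`(Y_t - m, (Y_t - m)(Y_t - m)ᵀ)`, which are square integrable by the fourth moment assumption,
followed by a smooth map and a deterministic rescaling. Finally, a sequence converging in
distribution is tight, which is `√n`-consistency.
-/

namespace CCA

open scoped Topology RealInnerProductSpace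

section ConvergenceInDistribution

variable {Ω Ω' : Type*} [MeasurableSpace Ω] [MeasurableSpace Ω'] {P : Measure Ω} {P' : Measure Ω'}
  {E F : Type*} [NormedAddCommGroup E] [NormedAddCommGroup F] {r : ℕ → ℝ}

/-- The sequence `X` is `O_P(1)`; `√n`-consistency says this of `√n (T n - θ)`. The bound is
required for every `n`, not only for large `n`. -/
def BoundedInProbability (P : Measure Ω) (X : ℕ → Ω → E) : Prop :=
  ∀ ε : ℝ, 0 < ε → ∃ M : ℝ, ∀ n, P.real {ω | M < ‖X n ω‖} ≤ ε

theorem tendstoInMeasure_smul_of_isLittleO [IsFiniteMeasure P] [NormedSpace ℝ E]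
    [NormedSpace ℝ F] (hr : Tendsto r atTop atTop) {X : ℕ → Ω → E}
    (hX : BoundedInProbability P fun n ω => r n • X n ω) {R : E → F} (hR : R =o[𝓝 0] id) :
    TendstoInMeasure P (fun n ω => r n • R (X n ω)) atTop 0 := by
  rw [tendstoInMeasure_iff_measureReal_norm]
  intro ε hε
  rw [tendsto_order]
  refine ⟨fun a ha => .of_forall fun n => ha.trans_le measureReal_nonneg, fun δ hδ => ?_⟩
  obtain ⟨M, hM⟩ := hX (δ / 2) (half_pos hδ)
  obtain ⟨K, hMK, hK⟩ : ∃ K, M ≤ K ∧ 0 < K := ⟨max M 1, le_max_left _ _, by positivity⟩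
  obtain ⟨ρ, hρ, hball⟩ :=
    Metric.eventually_nhds_iff.1 (hR.def (show 0 < ε / (2 * K) by positivity))
  filter_upwards [hr.eventually_gt_atTop (K / ρ)] with n hn
  have hrn : 0 < r n := (by positivity : 0 < K / ρ).trans hn
  refine (measureReal_mono ?_).trans_lt ((hM n).trans_lt (half_lt_self hδ))
  intro ω hω
  by_contra hle
  have hXK : r n * ‖X n ω‖ ≤ K := by
    simpa [norm_smul, abs_of_pos hrn] using (not_lt.1 hle).trans hMK
  have hsmall : dist (X n ω) 0 < ρ := by
    rw [div_lt_iff₀ hρ] at hn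
    simpa using lt_of_mul_lt_mul_left (hXK.trans_lt hn) hrn.le
  have hlt : ‖r n • R (X n ω)‖ < ε := calc
    ‖r n • R (X n ω)‖ = r n * ‖R (X n ω)‖ := by rw [norm_smul, Real.norm_of_nonneg hrn.le]
    _ ≤ r n * (ε / (2 * K) * ‖X n ω‖) := by gcongr; exact hball hsmall
    _ = ε / (2 * K) * (r n * ‖X n ω‖) := by ring
    _ ≤ ε / (2 * K) * K := by gcongr
    _ = ε / 2 := by field_simp
    _ < ε := half_lt_self hε
  exact hlt.not_ge (by simpa using hω)

theorem tendstoInDistribution_of_identDistrib_limit {ι T Ω'' : Type*} [TopologicalSpace T]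
    [MeasurableSpace T] [OpensMeasurableSpace T] [MeasurableSpace Ω''] {P'' : Measure Ω''}
    [IsProbabilityMeasure P] [IsProbabilityMeasure P'] [IsProbabilityMeasure P'']
    {X : ι → Ω → T} {l : Filter ι} {Z : Ω' → T} {W : Ω'' → T}
    (h : TendstoInDistribution X l Z (fun _ => P) P') (hZW : IdentDistrib Z W P' P'') :
    TendstoInDistribution X l W (fun _ => P) P'' where
  forall_aemeasurable := h.forall_aemeasurable
  aemeasurable_limit := hZW.aemeasurable_snd
  tendsto := by
    convert! h.tendsto using 2
    exact congrArg 𝓝 (Subtype.ext hZW.map_eq.symm)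

variable [MeasurableSpace E] [BorelSpace E] [MeasurableSpace F] [BorelSpace F]

theorem boundedInProbability_of_tendstoInDistribution [IsProbabilityMeasure P]
    [IsProbabilityMeasure P'] [SecondCountableTopology E] [CompleteSpace E]
    {X : ℕ → Ω → E} {Z : Ω' → E} (h : TendstoInDistribution X atTop Z (fun _ => P) P') :
    BoundedInProbability P X := by
  intro ε hε
  have htight := isTightMeasureSet_of_isCompact_closure
    (h.tendsto.isCompact_insert_range.closure_of_subset (Set.subset_insert _ _))
  obtain ⟨M, hM⟩ := ((ENNReal.tendsto_nhds_zero.1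
    (tendsto_measure_norm_gt_of_isTightMeasureSet htight)) (.ofReal ε) (by simpa using hε)).exists
  refine ⟨M, fun n => ENNReal.toReal_le_of_le_ofReal hε.le ?_⟩
  calc P {ω | M < ‖X n ω‖} = P.map (X n) {x | M < ‖x‖} :=
        (Measure.map_apply_of_aemeasurable (h.forall_aemeasurable n)
          (measurableSet_lt measurable_const measurable_norm)).symm
    _ ≤ _ := le_iSup₂_of_le (P.map (X n)) ⟨_, ⟨n, rfl⟩, rfl⟩ le_rfl
    _ ≤ .ofReal ε := hM

variable [NormedSpace ℝ E] [NormedSpace ℝ F]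

theorem tendstoInDistribution_delta_method [IsProbabilityMeasure P] [IsProbabilityMeasure P']
    [SecondCountableTopology E] [CompleteSpace E] [SecondCountableTopology F]
    (hr : Tendsto r atTop atTop) {T : ℕ → Ω → E} {θ : E} {Z : Ω' → E}
    (hT : TendstoInDistribution (fun n ω => r n • (T n ω - θ)) atTop Z (fun _ => P) P')
    {f : E → F} {f' : E →L[ℝ] F} (hf : HasFDerivAt f f' θ)
    (hm : ∀ n, AEMeasurable (fun ω => f (T n ω)) P) :
    TendstoInDistribution (fun n ω => r n • (f (T n ω) - f θ)) atTop (f' ∘ Z) (fun _ => P) P' := by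
  refine tendstoInDistribution_of_tendstoInMeasure_sub _ _ (hT.continuous_comp f'.continuous) ?_
    fun n => ((hm n).sub_const _).const_smul _
  have hR : (fun h => f (θ + h) - f θ - f' h) =o[𝓝 0] (id : E → E) :=
    hasFDerivAt_iff_isLittleO_nhds_zero.1 hf
  convert! tendstoInMeasure_smul_of_isLittleO hr
    (boundedInProbability_of_tendstoInDistribution hT) hR using 2 with n
  ext ω
  simp [smul_sub]

/-- `√n (T n - θ)` converges in distribution to a centred Gaussian law `ν`, the limit being
realised by the identity of the probability space `(E, ν)`. -/
def AsympNormal (P : Measure Ω) [IsProbabilityMeasure P] (T : ℕ → Ω → E) (θ : E) : Prop :=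
  ∃ (ν : Measure E) (_ : IsGaussian ν), ∫ x, x ∂ν = 0 ∧
    TendstoInDistribution (fun (n : ℕ) ω => √(n : ℝ) • (T n ω - θ)) atTop id (fun _ => P) ν

theorem AsympNormal.boundedInProbability [IsProbabilityMeasure P] [SecondCountableTopology E]
    [CompleteSpace E] {T : ℕ → Ω → E} {θ : E} (h : AsympNormal P T θ) :
    BoundedInProbability P fun n ω => √(n : ℝ) • (T n ω - θ) := by
  obtain ⟨ν, _, -, hT⟩ := h
  exact boundedInProbability_of_tendstoInDistribution hT

theorem tendsto_sqrt_natCast_atTop : Tendsto (fun n : ℕ => √(n : ℝ)) atTop atTop :=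
  Real.tendsto_sqrt_atTop.comp tendsto_natCast_atTop_atTop

theorem AsympNormal.comp_hasFDerivAt [IsProbabilityMeasure P] [SecondCountableTopology E]
    [CompleteSpace E] [SecondCountableTopology F] [CompleteSpace F] {T : ℕ → Ω → E} {θ : E}
    (h : AsympNormal P T θ) {f : E → F} {f' : E →L[ℝ] F} (hf : HasFDerivAt f f' θ)
    (hm : ∀ n, AEMeasurable (fun ω => f (T n ω)) P) :
    AsympNormal P (fun n ω => f (T n ω)) (f θ) := by
  obtain ⟨ν, _, hmean, hT⟩ := h
  refine ⟨ν.map f', inferInstance, ?_, ?_⟩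
  · rw [integral_map (by fun_prop) (by fun_prop),
      f'.integral_comp_id_comm IsGaussian.integrable_id, hmean, map_zero]
  · exact tendstoInDistribution_of_identDistrib_limit
      (tendstoInDistribution_delta_method tendsto_sqrt_natCast_atTop hT hf hm)
      ⟨by fun_prop, by fun_prop, by simp⟩

theorem AsympNormal.smul [IsProbabilityMeasure P] [SecondCountableTopology E]
    {T : ℕ → Ω → E} {θ : E} (h : AsympNormal P T θ) {c : ℕ → ℝ}
    (hc : Tendsto (fun n : ℕ => √(n : ℝ) * (c n - 1)) atTop (𝓝 0)) :
    AsympNormal P (fun n ω => c n • T n ω) θ := by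
  obtain ⟨ν, hν, hmean, hT⟩ := h
  refine ⟨ν, hν, hmean, ?_⟩
  have hc1 : Tendsto c atTop (𝓝 1) := by
    have := (tendsto_inv_atTop_zero.comp tendsto_sqrt_natCast_atTop).mul hc
    rw [mul_zero] at this
    refine tendsto_sub_nhds_zero_iff.1 (this.congr' ?_)
    filter_upwards [eventually_gt_atTop 0] with n hn
    have : √(n : ℝ) ≠ 0 := by positivity
    simp [this]
  have hconst : TendstoInMeasure P (fun (n : ℕ) (_ : Ω) => (c n, √(n : ℝ) * (c n - 1))) atTop
      (fun _ => ((1 : ℝ), (0 : ℝ))) :=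
    tendstoInMeasure_of_tendsto_ae (fun _ => aestronglyMeasurable_const)
      (ae_of_all _ fun _ => hc1.prodMk_nhds hc)
  have hslutsky := hT.continuous_comp_prodMk_of_tendstoInMeasure_const
    (g := fun q : E × ℝ × ℝ => q.2.1 • q.1 + q.2.2 • θ) (by fun_prop) hconst
    (fun _ => aemeasurable_const)
  convert! hslutsky using 1
  · ext n ω
    module
  · ext x
    simp

end ConvergenceInDistribution

section CentralLimit

variable {Ω : Type*} [MeasurableSpace Ω] {P : Measure Ω}

theorem charFun_map_eq_charFun_map_inner {E : Type*} [NormedAddCommGroup E]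
    [InnerProductSpace ℝ E] [MeasurableSpace E] [BorelSpace E] [SecondCountableTopology E]
    {X : Ω → E} (hX : AEMeasurable X P) (t : E) :
    charFun (P.map X) t = charFun (P.map fun ω => ⟪t, X ω⟫) 1 := by
  rw [charFun_apply, charFun_apply_real, integral_map hX (by fun_prop),
    integral_map (by fun_prop) (by fun_prop)]
  simp [real_inner_comm]

/-- The Cramér–Wold device. -/
theorem tendstoInDistribution_of_inner {E Ω' : Type*} [MeasurableSpace Ω'] {P' : Measure Ω'}
    [IsProbabilityMeasure P] [IsProbabilityMeasure P'] [NormedAddCommGroup E]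
    [InnerProductSpace ℝ E] [FiniteDimensional ℝ E] [MeasurableSpace E] [BorelSpace E]
    {X : ℕ → Ω → E} {Z : Ω' → E} (hX : ∀ n, AEMeasurable (X n) P) (hZ : AEMeasurable Z P')
    (h : ∀ t, TendstoInDistribution (fun n ω => ⟪t, X n ω⟫) atTop (fun ω => ⟪t, Z ω⟫)
      (fun _ => P) P') :
    TendstoInDistribution X atTop Z (fun _ => P) P' := by
  refine ⟨hX, hZ, ProbabilityMeasure.tendsto_iff_tendsto_charFun.2 fun t => ?_⟩
  simpa only [ProbabilityMeasure.coe_mk, charFun_map_eq_charFun_map_inner (hX _),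
    charFun_map_eq_charFun_map_inner hZ] using
    ProbabilityMeasure.tendsto_iff_tendsto_charFun.1 (h t).tendsto 1

theorem exists_isGaussian_covarianceBilin_eq {ι : Type*} [Fintype ι]
    (μ : Measure (EuclideanSpace ℝ ι)) :
    ∃ (ν : Measure (EuclideanSpace ℝ ι)) (_ : IsGaussian ν),
      ∫ x, x ∂ν = 0 ∧ covarianceBilin ν = covarianceBilin μ := by
  classical
  let b := (EuclideanSpace.basisFun ι ℝ).toBasis
  let B := (covarianceBilin μ).toBilinForm
  have hS : (LinearMap.BilinForm.toMatrix b B).PosSemidef := by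
    refine PosSemidef.of_dotProduct_mulVec_nonneg ?_ fun x => ?_
    · ext i j
      simp [B, LinearMap.BilinForm.toMatrix_apply, covarianceBilin_comm]
    · rw [star_trivial, LinearMap.BilinForm.dotProduct_toMatrix_mulVec]
      exact covarianceBilin_self_nonneg _
  refine ⟨multivariateGaussian 0 (LinearMap.BilinForm.toMatrix b B), inferInstance, by simp, ?_⟩
  ext x y
  rw [covarianceBilin_multivariateGaussian hS]
  exact (LinearMap.BilinForm.apply_eq_dotProduct_toMatrix_mulVec b B x y).symm

theorem hasLaw_inner_gaussianReal {E : Type*} [NormedAddCommGroup E]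
    [InnerProductSpace ℝ E] [CompleteSpace E] [SecondCountableTopology E] [MeasurableSpace E]
    [BorelSpace E] {ν : Measure E} [IsGaussian ν] (hν : ∫ x, x ∂ν = 0) (t : E) :
    HasLaw (fun x => ⟪t, x⟫) (gaussianReal 0 (covarianceBilin ν t t).toNNReal) ν where
  map_eq := by
    have hmean : ∫ x, ⟪t, x⟫ ∂ν = 0 := by
      rw [integral_inner (f := fun x => x) IsGaussian.integrable_id, hν, inner_zero_right]
    rw [covarianceBilin_self IsGaussian.memLp_two_id, ← hmean]
    exact IsGaussian.map_eq_gaussianReal (innerSL ℝ t)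

theorem inv_sqrt_mul_sum_sub_eq_inner {E : Type*} [NormedAddCommGroup E]
    [InnerProductSpace ℝ E] (n : ℕ) (x : ℕ → E) (t m : E) :
    (√(n : ℝ))⁻¹ * (∑ k ∈ Finset.range n, ⟪t, x k⟫ - n * ⟪t, m⟫) =
      ⟪t, √(n : ℝ) • ((n : ℝ)⁻¹ • ∑ k ∈ Finset.range n, x k - m)⟫ := by
  rcases eq_or_ne n 0 with rfl | hn
  · simp
  have hn' : √(n : ℝ) ≠ 0 := by positivity
  simp only [inner_smul_right, inner_sub_right, inner_sum]
  field_simp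
  rw [Real.sq_sqrt n.cast_nonneg]

variable [IsProbabilityMeasure P] {E : Type*} [NormedAddCommGroup E] [MeasurableSpace E]
  [BorelSpace E] {X : ℕ → Ω → E}

theorem asympNormal_mean_euclideanSpace {ι : Type*} [Fintype ι]
    {X : ℕ → Ω → EuclideanSpace ℝ ι} (hindep : iIndepFun X P)
    (hident : ∀ k, IdentDistrib (X k) (X 0) P P) (hX : MemLp (X 0) 2 P) :
    AsympNormal P (fun n ω => (n : ℝ)⁻¹ • ∑ k ∈ Finset.range n, X k ω) (∫ ω, X 0 ω ∂P) := by
  obtain ⟨ν, hν, hmean, hcov⟩ := exists_isGaussian_covarianceBilin_eq (P.map (X 0))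
  have hmX (k : ℕ) : AEMeasurable (X k) P := (hident k).aemeasurable_fst
  have : ∀ n : ℕ, AEMeasurable (fun ω => ∑ k ∈ Finset.range n, X k ω) P := fun n =>
    Finset.aemeasurable_fun_sum _ fun k _ => hmX k
  refine ⟨ν, hν, hmean, tendstoInDistribution_of_inner (by fun_prop) (by fun_prop) fun t => ?_⟩
  have hvar : covarianceBilin ν t t = Var[fun ω => ⟪t, X 0 ω⟫; P] := by
    have := Measure.isProbabilityMeasure_map (hmX 0)
    rw [hcov, covarianceBilin_self ((memLp_map_measure_iff (by fun_prop) (hmX 0)).2 hX),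
      variance_map (by fun_prop) (hmX 0)]
    rfl
  have hclt := tendstoInDistribution_inv_sqrt_mul_sum_sub (X := fun k ω => ⟪t, X k ω⟫)
    (hvar ▸ hasLaw_inner_gaussianReal hmean t) (hX.const_inner t)
    (hindep.comp (fun _ x => ⟪t, x⟫) fun _ => by fun_prop)
    (fun k => (hident k).comp (u := fun x => ⟪t, x⟫) (by fun_prop))
  simpa only [integral_inner (hX.integrable one_le_two), inv_sqrt_mul_sum_sub_eq_inner, id]
    using hclt

theorem asympNormal_mean [NormedSpace ℝ E] [FiniteDimensional ℝ E] (hindep : iIndepFun X P)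
    (hident : ∀ k, IdentDistrib (X k) (X 0) P P) (hX : MemLp (X 0) 2 P) :
    AsympNormal P (fun n ω => (n : ℝ)⁻¹ • ∑ k ∈ Finset.range n, X k ω) (∫ ω, X 0 ω ∂P) := by
  have hmX (k : ℕ) : AEMeasurable (X k) P := (hident k).aemeasurable_fst
  have : ∀ n : ℕ, AEMeasurable (fun ω => ∑ k ∈ Finset.range n, X k ω) P := fun n =>
    Finset.aemeasurable_fun_sum _ fun k _ => hmX k
  let e : E ≃L[ℝ] EuclideanSpace ℝ (Fin (Module.finrank ℝ E)) := toEuclidean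
  have hclt := asympNormal_mean_euclideanSpace (hindep.comp (fun _ => e) fun _ => by fun_prop)
    (fun k => (hident k).comp (by fun_prop)) (e.toContinuousLinearMap.comp_memLp' hX)
  convert! hclt.comp_hasFDerivAt e.symm.toContinuousLinearMap.hasFDerivAt fun n => ?_ using 1
  · simp
  · simp [e.integral_comp_comm]
  · simp only [Function.comp_apply, ← map_sum, ← map_smul]
    fun_prop

end CentralLimit

section Triangular

theorem inv_mul_transpose_mul_self {n R : Type*} [Fintype n] [DecidableEq n] [CommRing R]
    {A : Matrix n n R} (hdet : IsUnit A.det) : (A * Aᵀ)⁻¹ * A = A⁻¹ᵀ := by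
  rw [Matrix.mul_inv_rev, Matrix.mul_assoc, nonsing_inv_mul A hdet, Matrix.mul_one,
    transpose_nonsing_inv]

section CommRing

variable {m R : Type*} [Fintype m] [LinearOrder m] [CommRing R] {A B : Matrix m m R}

theorem isLowerTriangular_inv (hA : A.IsLowerTriangular) : A⁻¹.IsLowerTriangular := by
  by_cases hdet : IsUnit A.det
  · have := A.invertibleOfIsUnitDet hdet
    exact blockTriangular_inv_of_blockTriangular hA
  · simp [nonsing_inv_apply_not_isUnit A hdet]

theorem mul_apply_self_of_isLowerTriangular (hA : A.IsLowerTriangular)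
    (hB : B.IsLowerTriangular) (i : m) : (A * B) i i = A i i * B i i := by
  rw [mul_apply, Finset.sum_eq_single i _ (by simp)]
  intro k _ hki
  rcases hki.lt_or_gt with hki | hki
  · rw [hB hki, mul_zero]
  · rw [hA hki, zero_mul]

theorem inv_apply_self_mul_of_isLowerTriangular (hA : A.IsLowerTriangular)
    (hdet : IsUnit A.det) (i : m) : A⁻¹ i i * A i i = 1 := by
  rw [← mul_apply_self_of_isLowerTriangular (isLowerTriangular_inv hA) hA,
    nonsing_inv_mul A hdet, one_apply_eq]

end CommRing

variable {p : ℕ} {A L M : Matrix (Fin p) (Fin p) ℝ}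

theorem isLowerTriangular_of_mem_lowerPos (hL : L ∈ lowerPos p) : L.IsLowerTriangular :=
  fun i j => hL.1 i j

theorem isUnit_det_of_mem_lowerPos (hL : L ∈ lowerPos p) : IsUnit L.det := by
  rw [isUnit_iff_ne_zero, det_of_isLowerTriangular L (isLowerTriangular_of_mem_lowerPos hL)]
  exact Finset.prod_ne_zero_iff.2 fun i _ => (hL.2 i).ne'

theorem posDef_mul_transpose_self (hM : IsUnit M.det) : (M * Mᵀ).PosDef := by
  simpa using PosDef.mul_conjTranspose_self M
    (vecMul_injective_of_isUnit ((isUnit_iff_isUnit_det M).2 hM))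

theorem exists_mem_lowerPos_mul_transpose_eq (hM : M.IsLowerTriangular) (hdet : IsUnit M.det) :
    ∃ L ∈ lowerPos p, L * Lᵀ = M * Mᵀ := by
  have hdiag (j : Fin p) : M j j ≠ 0 :=
    right_ne_zero_of_mul_eq_one (inv_apply_self_mul_of_isLowerTriangular hM hdet j)
  let s (j : Fin p) : ℝ := SignType.sign (M j j)
  have hs : diagonal s * diagonal s = 1 := by
    rw [diagonal_mul_diagonal, ← diagonal_one]
    congr 1 with j
    rcases (hdiag j).lt_or_gt with h | h <;> simp [s, h]
  refine ⟨M * diagonal s, ⟨fun i j hij => ?_, fun j => ?_⟩, ?_⟩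
  · rw [mul_diagonal, hM hij, zero_mul]
  · rw [mul_diagonal, self_mul_sign]
    exact abs_pos.2 (hdiag j)
  · rw [transpose_mul, diagonal_transpose, Matrix.mul_assoc, ← Matrix.mul_assoc (diagonal s), hs,
      Matrix.one_mul]

theorem exists_cholesky (hA : A.PosDef) : ∃ L ∈ lowerPos p, L * Lᵀ = A := by
  have hdet : IsUnit (LDL.lowerInv hA).det := isUnit_det_of_invertible _
  have hlow : (LDL.lower hA).IsLowerTriangular :=
    isLowerTriangular_inv fun _ _ => LDL.lowerInv_triangular hA
  have hD : ∀ i, 0 < LDL.diagEntries hA i := by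
    have : (LDL.diag hA).PosDef := by
      rw [LDL.diag_eq_lowerInv_conj]
      exact hA.mul_mul_conjTranspose_same
        (vecMul_injective_of_isUnit ((isUnit_iff_isUnit_det _).2 hdet))
    exact posDef_diagonal_iff.1 this
  let N := LDL.lower hA * diagonal fun i => √(LDL.diagEntries hA i)
  have hN : N * Nᵀ = A := by
    rw [transpose_mul, diagonal_transpose, Matrix.mul_assoc, ← Matrix.mul_assoc (diagonal _),
      diagonal_mul_diagonal, ← Matrix.mul_assoc]
    simp_rw [Real.mul_self_sqrt (hD _).le]
    exact LDL.lower_conj_diag hA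
  rw [← hN]
  refine exists_mem_lowerPos_mul_transpose_eq (hlow.mul (blockTriangular_diagonal _)) ?_
  rw [det_mul, det_diagonal]
  exact (isUnit_nonsing_inv_det _ hdet).mul
    (Finset.prod_ne_zero_iff.2 fun i _ => (Real.sqrt_pos.2 (hD i)).ne').isUnit

end Triangular

section ExactRecovery

variable {p : ℕ} {H D : SimpleGraph (Fin p)} {A L S : Matrix (Fin p) (Fin p) ℝ}

/-- The matrices in `𝕃⁺` whose nonzero entries below the diagonal sit on the edges of `D`. These
are the Cholesky factors that Step I recovers exactly. -/
def sparseLowerPos (D : SimpleGraph (Fin p)) : Set (Matrix (Fin p) (Fin p) ℝ) :=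
  {L | L ∈ lowerPos p ∧ ∀ i j, j < i → ¬ D.Adj i j → L i j = 0}

theorem cholSpace_subset_sparseLowerPos_filledGraph :
    cholSpace H ⊆ sparseLowerPos (filledGraph H) :=
  fun L hL => ⟨hL.1, (isLeast_filledGraph H).1.chol_zero L hL⟩

open Classical in
theorem mul_apply_of_mem_sparseLowerPos (hL : L ∈ sparseLowerPos D) (i j : Fin p) :
    (S * L) i j = S i j * L j j + (fun k : LaterNbr D j => S i k) ⬝ᵥ colGt D L j := by
  have hsupp : ∀ k ∈ Finset.univ.erase j, k ∉ Finset.univ.filter (fun k => j < k ∧ D.Adj k j) →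
      S i k * L k j = 0 := by
    intro k hk hk'
    rcases (Finset.ne_of_mem_erase hk).lt_or_gt with h | h
    · rw [hL.1.1 k j h, mul_zero]
    · rw [hL.2 k j h fun hadj => hk' (by simp [h, hadj]), mul_zero]
  rw [mul_apply, ← Finset.add_sum_erase _ _ (Finset.mem_univ j)]
  congr 1
  rw [← Finset.sum_subset (fun k hk => by simp_all [ne_of_gt]) hsupp,
    Finset.sum_subtype (p := fun k => j < k ∧ D.Adj k j) _ (by simp)]
  rfl

open Classical in
theorem isUnit_det_blockGt (hS : S.PosDef) (j : Fin p) : IsUnit (blockGt D S j).det :=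
  (hS.submatrix (Subtype.val_injective (p := fun k => j < k ∧ D.Adj k j))).det_pos.ne'.isUnit

theorem posDef_inv_mul_transpose (hL : L ∈ lowerPos p) : (L * Lᵀ)⁻¹.PosDef :=
  (posDef_mul_transpose_self (isUnit_det_of_mem_lowerPos hL)).inv

-- The covariance `S = (L Lᵀ)⁻¹` satisfies `S L = (L⁻¹)ᵀ`, which is upper triangular: the entries
-- of column `j` on the later neighbours of `j` vanish.
theorem regCoef_inv_mul_transpose (hL : L ∈ sparseLowerPos D) (j : Fin p) :
    regCoef D (L * Lᵀ)⁻¹ j = -(L j j)⁻¹ • colGt D L j := by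
  classical
  have hdet := isUnit_det_of_mem_lowerPos hL.1
  have hcol : colGt D (L * Lᵀ)⁻¹ j = blockGt D (L * Lᵀ)⁻¹ j *ᵥ (-(L j j)⁻¹ • colGt D L j) := by
    ext k
    have hzero : ((L * Lᵀ)⁻¹ * L) k j = 0 := by
      rw [inv_mul_transpose_mul_self hdet]
      exact isLowerTriangular_inv (isLowerTriangular_of_mem_lowerPos hL.1) k.2.1
    have hLj : L j j ≠ 0 := (hL.1.2 j).ne'
    rw [mul_apply_of_mem_sparseLowerPos hL] at hzero
    rw [mulVec_smul, Pi.smul_apply, smul_eq_mul, neg_mul, eq_neg_iff_add_eq_zero,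
      ← mul_right_inj' hLj, mul_zero, ← hzero, mul_add, mul_inv_cancel_left₀ hLj, mul_comm]
    rfl
  rw [regCoef, hcol, mulVec_mulVec,
    nonsing_inv_mul _ (isUnit_det_blockGt (posDef_inv_mul_transpose hL.1) j), one_mulVec]

theorem residVar_inv_mul_transpose (hL : L ∈ sparseLowerPos D) (j : Fin p) :
    residVar D (L * Lᵀ)⁻¹ j = (L j j)⁻¹ ^ 2 := by
  classical
  have hLj : L j j ≠ 0 := (hL.1.2 j).ne'
  have hdiag : ((L * Lᵀ)⁻¹ * L) j j = (L j j)⁻¹ := by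
    have hdet := isUnit_det_of_mem_lowerPos hL.1
    rw [inv_mul_transpose_mul_self hdet]
    exact eq_inv_of_mul_eq_one_left (inv_apply_self_mul_of_isLowerTriangular
      (isLowerTriangular_of_mem_lowerPos hL.1) hdet j)
  have hsymm : (fun k : LaterNbr D j => (L * Lᵀ)⁻¹ j k) = colGt D (L * Lᵀ)⁻¹ j :=
    funext fun k => ((posDef_inv_mul_transpose hL.1).isHermitian.apply j k).symm
  rw [mul_apply_of_mem_sparseLowerPos hL, hsymm] at hdiag
  rw [residVar, regCoef_inv_mul_transpose hL, dotProduct_smul, smul_eq_mul, neg_mul,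
    sub_neg_eq_add, sq, ← hdiag, mul_add, hdiag, mul_left_comm,
    inv_mul_cancel₀ hLj, mul_one]

theorem interChol_inv_mul_transpose (hL : L ∈ sparseLowerPos D) : interChol D (L * Lᵀ)⁻¹ = L := by
  ext i j
  have hsqrt : √(residVar D (L * Lᵀ)⁻¹ j) = (L j j)⁻¹ := by
    rw [residVar_inv_mul_transpose hL, Real.sqrt_sq (inv_nonneg.2 (hL.1.2 j).le)]
  have hLj : L j j ≠ 0 := (hL.1.2 j).ne'
  simp only [interChol, of_apply, hsqrt, regCoef_inv_mul_transpose hL]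
  split_ifs with hij hadj
  · rw [hij, one_div, inv_inv]
  · simp only [Pi.smul_apply, colGt, smul_eq_mul]
    field_simp
  · rcases Ne.lt_or_gt hij with h | h
    · exact (hL.1.1 i j h).symm
    · exact (hL.2 i j h fun h' => hadj ⟨h, h'⟩).symm

theorem mul_transpose_apply_of_isLowerTriangular (hL : L.IsLowerTriangular) (i j : Fin p) :
    (L * Lᵀ) i j =
      ∑ k ∈ Finset.univ.filter (fun k => k < j), L i k * L j k + L i j * L j j := by
  rw [mul_apply, ← Finset.sum_filter_add_sum_filter_not Finset.univ (fun k => k < j)]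
  congr 1
  refine Finset.sum_eq_single j (fun k hk hkj => ?_) (by simp)
  have hjk : j < k := lt_of_le_of_ne (by simpa using hk) hkj.symm
  rw [transpose_apply, hL hjk, mul_zero]

theorem updateEntry_eq_self (hL : L ∈ cholSpace H) {i j : Fin p} (hij : i ≠ j) :
    updateEntry H i j L = L := by
  unfold updateEntry
  split_ifs with hadj
  · rfl
  ext a b
  rw [of_apply]
  split_ifs with hab
  · obtain ⟨rfl, rfl⟩ := hab
    have hzero := hL.2.2 a b hij hadj
    rw [mul_transpose_apply_of_isLowerTriangular (isLowerTriangular_of_mem_lowerPos hL.1)] at hzero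
    rw [div_eq_iff (hL.1.2 b).ne']
    linarith
  · rfl

theorem foldl_comp_induction {α β γ : Type*} {Q : (γ → β) → Prop} {f : β → α → β} (l : List α)
    (hf : ∀ a ∈ l, ∀ M, Q M → Q fun x => f (M x) a) {M : γ → β} (hM : Q M) :
    Q fun x => l.foldl f (M x) := by
  induction l generalizing M with
  | nil => exact hM
  | cons a l ih =>
    exact ih (fun b hb => hf b (List.mem_cons_of_mem a hb)) (hf a List.mem_cons_self M hM)

theorem stepTwo_comp_induction {γ : Type*} {Q : (γ → Matrix (Fin p) (Fin p) ℝ) → Prop}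
    (hstep : ∀ i j, j < i → ∀ M, Q M → Q fun x => updateEntry H i j (M x))
    {M : γ → Matrix (Fin p) (Fin p) ℝ} (hM : Q M) : Q fun x => stepTwo H (M x) :=
  foldl_comp_induction (Q := Q) (f := fun L i =>
    ((List.finRange p).filter (fun j => decide (j < i))).foldl (fun L j => updateEntry H i j L) L) _
    (fun i _ _ hM => foldl_comp_induction (Q := Q)
      (f := fun L j => updateEntry H i j L) _
      (fun j hj M hM => hstep i j (by simpa using hj) M hM) hM) hM

theorem stepTwo_eq_self (hL : L ∈ cholSpace H) : stepTwo H L = L :=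
  stepTwo_comp_induction (γ := Unit) (Q := fun M => M () = L)
    (fun _ _ hij _ hM => hM.symm ▸ updateEntry_eq_self hL hij.ne') (M := fun _ => L) rfl

theorem ccaEstimator_inv_eq_self (hA : A ∈ posDefSpace H) : ccaEstimator H A⁻¹ = A := by
  obtain ⟨L, hL, rfl⟩ := exists_cholesky hA.1
  rw [ccaEstimator, ccaChol,
    interChol_inv_mul_transpose (cholSpace_subset_sparseLowerPos_filledGraph ⟨hL, hA⟩),
    stepTwo_eq_self ⟨hL, hA⟩]

end ExactRecovery

section Regularity

variable {n : Type*} [Fintype n] [DecidableEq n] {p : ℕ} {H D : SimpleGraph (Fin p)}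

section Measurable

variable {E : Type*} [MeasurableSpace E]

theorem measurable_det_of_entries {M : E → Matrix n n ℝ}
    (hM : ∀ i j, Measurable fun x => M x i j) : Measurable fun x => (M x).det := by
  simp only [det_apply]
  fun_prop

theorem measurable_inv_of_entries {M : E → Matrix n n ℝ}
    (hM : ∀ i j, Measurable fun x => M x i j) (i j : n) : Measurable fun x => (M x)⁻¹ i j := by
  have hadj : Measurable fun x => (M x).adjugate i j := by
    simp only [adjugate_apply]
    refine measurable_det_of_entries fun a b => ?_
    simp only [updateRow_apply]
    split_ifs
    · exact measurable_const
    · exact hM a b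
  simp only [inv_def, Ring.inverse_eq_inv', Matrix.smul_apply, smul_eq_mul]
  exact (measurable_det_of_entries hM).inv.mul hadj

variable {S : E → Matrix (Fin p) (Fin p) ℝ}

theorem measurable_regCoef (hS : ∀ i j, Measurable fun x => S x i j) (j : Fin p)
    (k : LaterNbr D j) : Measurable fun x => regCoef D (S x) j k := by
  classical
  simp only [regCoef, mulVec, dotProduct]
  refine Finset.measurable_sum _ fun l _ => Measurable.mul ?_ (hS l j)
  exact measurable_inv_of_entries (M := fun x => blockGt D (S x) j) (fun a b => hS a b) k l

theorem measurable_residVar (hS : ∀ i j, Measurable fun x => S x i j) (j : Fin p) :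
    Measurable fun x => residVar D (S x) j :=
  (hS j j).sub (Finset.measurable_sum _ fun k _ => (hS k j).mul (measurable_regCoef hS j k))

theorem measurable_interChol (hS : ∀ i j, Measurable fun x => S x i j) (i j : Fin p) :
    Measurable fun x => interChol D (S x) i j := by
  simp only [interChol, of_apply]
  split_ifs
  · exact measurable_const.div (measurable_residVar hS j).sqrt
  · exact (measurable_regCoef hS j _).neg.div (measurable_residVar hS j).sqrt
  · exact measurable_const

theorem measurable_updateEntry (i j : Fin p) {M : E → Matrix (Fin p) (Fin p) ℝ}
    (hM : ∀ a b, Measurable fun x => M x a b) (a b : Fin p) :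
    Measurable fun x => updateEntry H i j (M x) a b := by
  unfold updateEntry
  split_ifs
  · exact hM a b
  simp only [of_apply]
  split_ifs
  · exact (Finset.measurable_sum _ fun k _ => (hM i k).mul (hM j k)).neg.div (hM j j)
  · exact hM a b

theorem measurable_ccaEstimator (hS : ∀ i j, Measurable fun x => S x i j) (i j : Fin p) :
    Measurable fun x => ccaEstimator H (S x) i j := by
  have hL : ∀ a b, Measurable fun x => ccaChol H (S x) a b :=
    stepTwo_comp_induction (H := H) (Q := fun M => ∀ a b, Measurable fun x => M x a b)
      (fun i j _ _ hM => measurable_updateEntry i j hM) (measurable_interChol hS)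
  simp only [ccaEstimator, mul_apply, transpose_apply]
  exact Finset.measurable_sum _ fun k _ => (hL i k).mul (hL j k)

end Measurable

theorem submatrix_sumElim_eq_fromBlocks {S : Matrix (Fin p) (Fin p) ℝ} (hS : S.IsHermitian)
    (j : Fin p) :
    S.submatrix (Sum.elim (fun _ : Unit => j) (Subtype.val : LaterNbr D j → Fin p))
        (Sum.elim (fun _ : Unit => j) (Subtype.val : LaterNbr D j → Fin p)) =
      fromBlocks (of fun _ _ => S j j) (replicateRow Unit (colGt D S j))
        (replicateCol Unit (colGt D S j)) (blockGt D S j) := by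
  ext (_ | k) (_ | l)
  · rfl
  · exact (hS.apply j l).symm
  · rfl
  · rfl

theorem residVar_pos {S : Matrix (Fin p) (Fin p) ℝ} (hS : S.PosDef) (j : Fin p) :
    0 < residVar D S j := by
  classical
  have hinj : Function.Injective
      (Sum.elim (fun _ : Unit => j) (Subtype.val : LaterNbr D j → Fin p)) :=
    Function.injective_of_subsingleton _ |>.sumElim Subtype.val_injective fun _ k => k.2.1.ne
  have := (blockGt D S j).invertibleOfIsUnitDet (isUnit_det_blockGt hS j)
  have hblock : 0 < (blockGt D S j).det :=
    (hS.submatrix (Subtype.val_injective (p := fun k => j < k ∧ D.Adj k j))).det_pos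
  have hschur := (hS.submatrix hinj).det_pos
  rw [submatrix_sumElim_eq_fromBlocks hS.isHermitian, det_fromBlocks₂₂] at hschur
  convert! pos_of_mul_pos_right hschur hblock.le
  rw [det_unique, invOf_eq_nonsing_inv, Matrix.mul_assoc]
  simp only [residVar, regCoef, Matrix.sub_apply, of_apply, mul_apply, dotProduct, mulVec,
    replicateRow_apply, replicateCol_apply]

section Differentiable

variable {E : Type*} [NormedAddCommGroup E] [NormedSpace ℝ E] {x₀ : E}

theorem differentiableAt_det_of_entries {M : E → Matrix n n ℝ}
    (hM : ∀ i j, DifferentiableAt ℝ (fun x => M x i j) x₀) :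
    DifferentiableAt ℝ (fun x => (M x).det) x₀ := by
  simp only [det_apply]
  fun_prop

theorem differentiableAt_inv_of_entries {M : E → Matrix n n ℝ}
    (hM : ∀ i j, DifferentiableAt ℝ (fun x => M x i j) x₀) (hdet : (M x₀).det ≠ 0) (i j : n) :
    DifferentiableAt ℝ (fun x => (M x)⁻¹ i j) x₀ := by
  have hadj : DifferentiableAt ℝ (fun x => (M x).adjugate i j) x₀ := by
    simp only [adjugate_apply]
    refine differentiableAt_det_of_entries fun a b => ?_
    simp only [updateRow_apply]
    split_ifs
    · exact differentiableAt_const _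
    · exact hM a b
  simp only [inv_def, Ring.inverse_eq_inv', Matrix.smul_apply, smul_eq_mul]
  exact ((differentiableAt_det_of_entries hM).inv hdet).mul hadj

variable {S : E → Matrix (Fin p) (Fin p) ℝ}

theorem differentiableAt_regCoef (hS : ∀ i j, DifferentiableAt ℝ (fun x => S x i j) x₀)
    (hpos : (S x₀).PosDef) (j : Fin p) (k : LaterNbr D j) :
    DifferentiableAt ℝ (fun x => regCoef D (S x) j k) x₀ := by
  classical
  simp only [regCoef, mulVec, dotProduct]
  refine DifferentiableAt.fun_sum fun l _ => DifferentiableAt.mul ?_ (hS l j)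
  exact differentiableAt_inv_of_entries (M := fun x => blockGt D (S x) j)
    (fun a b => hS a b) (isUnit_det_blockGt hpos j).ne_zero k l

theorem differentiableAt_residVar (hS : ∀ i j, DifferentiableAt ℝ (fun x => S x i j) x₀)
    (hpos : (S x₀).PosDef) (j : Fin p) : DifferentiableAt ℝ (fun x => residVar D (S x) j) x₀ :=
  (hS j j).sub (DifferentiableAt.fun_sum fun k _ =>
    (hS k j).mul (differentiableAt_regCoef hS hpos j k))

theorem interChol_apply_self_pos {S : Matrix (Fin p) (Fin p) ℝ} (hS : S.PosDef) (j : Fin p) :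
    0 < interChol D S j j := by
  simpa [interChol] using residVar_pos hS j

theorem differentiableAt_interChol (hS : ∀ i j, DifferentiableAt ℝ (fun x => S x i j) x₀)
    (hpos : (S x₀).PosDef) (i j : Fin p) :
    DifferentiableAt ℝ (fun x => interChol D (S x) i j) x₀ := by
  have hr : 0 < residVar D (S x₀) j := residVar_pos hpos j
  have hsqrt : DifferentiableAt ℝ (fun x => √(residVar D (S x) j)) x₀ :=
    (differentiableAt_residVar hS hpos j).sqrt hr.ne'
  have hinv : DifferentiableAt ℝ (fun x => (√(residVar D (S x) j))⁻¹) x₀ :=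
    hsqrt.inv (Real.sqrt_pos.2 hr).ne'
  simp only [interChol, of_apply, div_eq_mul_inv]
  split_ifs
  · exact (differentiableAt_const _).mul hinv
  · exact (differentiableAt_regCoef hS hpos j _).neg.mul hinv
  · exact differentiableAt_const _

theorem updateEntry_apply_self {i j : Fin p} (hij : i ≠ j) (M : Matrix (Fin p) (Fin p) ℝ)
    (k : Fin p) : updateEntry H i j M k k = M k k := by
  unfold updateEntry
  split_ifs
  · rfl
  · rw [of_apply, if_neg]
    rintro ⟨rfl, rfl⟩
    exact hij rfl

theorem differentiableAt_updateEntry {i j : Fin p} {M : E → Matrix (Fin p) (Fin p) ℝ}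
    (hM : ∀ a b, DifferentiableAt ℝ (fun x => M x a b) x₀) (hj : M x₀ j j ≠ 0) (a b : Fin p) :
    DifferentiableAt ℝ (fun x => updateEntry H i j (M x) a b) x₀ := by
  unfold updateEntry
  split_ifs
  · exact hM a b
  simp only [of_apply, div_eq_mul_inv]
  split_ifs
  · exact (DifferentiableAt.fun_sum fun k _ => (hM i k).mul (hM j k)).neg.mul ((hM j j).inv hj)
  · exact hM a b

theorem differentiableAt_stepTwo {M : E → Matrix (Fin p) (Fin p) ℝ}
    (hM : ∀ a b, DifferentiableAt ℝ (fun x => M x a b) x₀) (hdiag : ∀ k, M x₀ k k ≠ 0)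
    (a b : Fin p) : DifferentiableAt ℝ (fun x => stepTwo H (M x) a b) x₀ :=
  (stepTwo_comp_induction (H := H) (Q := fun M => (∀ k, M x₀ k k ≠ 0) ∧
      ∀ a b, DifferentiableAt ℝ (fun x => M x a b) x₀)
    (fun i j hij M hM => ⟨fun k => by simpa only [updateEntry_apply_self hij.ne'] using hM.1 k,
      differentiableAt_updateEntry hM.2 (hM.1 j)⟩) ⟨hdiag, hM⟩).2 a b

theorem differentiableAt_ccaEstimator (hS : ∀ i j, DifferentiableAt ℝ (fun x => S x i j) x₀)
    (hpos : (S x₀).PosDef) (i j : Fin p) :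
    DifferentiableAt ℝ (fun x => ccaEstimator H (S x) i j) x₀ := by
  have hL : ∀ a b, DifferentiableAt ℝ (fun x => ccaChol H (S x) a b) x₀ :=
    differentiableAt_stepTwo (differentiableAt_interChol hS hpos)
      fun k => (interChol_apply_self_pos hpos k).ne'
  simp only [ccaEstimator, mul_apply, transpose_apply]
  exact DifferentiableAt.fun_sum fun k _ => (hL i k).mul (hL j k)

end Differentiable

end Regularity

section SampleCovariance

theorem inv_mul_sum_sub_mean_mul_sub_mean (n : ℕ) (a b : ℕ → ℝ) (m m' : ℝ) :
    (n : ℝ)⁻¹ * ∑ t ∈ Finset.range n, (a t - (n : ℝ)⁻¹ * ∑ s ∈ Finset.range n, a s) *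
        (b t - (n : ℝ)⁻¹ * ∑ s ∈ Finset.range n, b s) =
      (n : ℝ)⁻¹ * ∑ t ∈ Finset.range n, (a t - m) * (b t - m') -
        ((n : ℝ)⁻¹ * ∑ t ∈ Finset.range n, (a t - m)) *
          ((n : ℝ)⁻¹ * ∑ t ∈ Finset.range n, (b t - m')) := by
  rcases Nat.eq_zero_or_pos n with rfl | hn
  · simp
  simp only [sub_mul, mul_sub, Finset.sum_sub_distrib, ← Finset.mul_sum, ← Finset.sum_mul,
    Finset.sum_const, Finset.card_range, nsmul_eq_mul]
  field_simp
  ring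

theorem tendsto_sqrt_mul_bessel_sub_one :
    Tendsto (fun n : ℕ => √(n : ℝ) * (n * ((n : ℝ) - 1)⁻¹ - 1)) atTop (𝓝 0) := by
  have hratio : Tendsto (fun n : ℕ => (n : ℝ) / (n + (-1))) atTop (𝓝 1) :=
    tendsto_natCast_div_add_atTop (-1)
  have hprod := (tendsto_inv_atTop_zero.comp tendsto_sqrt_natCast_atTop).mul hratio
  rw [zero_mul] at hprod
  refine hprod.congr' ?_
  filter_upwards [eventually_ge_atTop 2] with n hn
  have hn1 : (n : ℝ) - 1 ≠ 0 := by
    have : (2 : ℝ) ≤ n := by exact_mod_cast hn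
    linarith
  have hsqrt : √(n : ℝ) * √(n : ℝ) = n := Real.mul_self_sqrt n.cast_nonneg
  have hsqrt0 : √(n : ℝ) ≠ 0 := by positivity
  simp only [Function.comp_apply, ← sub_eq_add_neg]
  field_simp
  rw [sq, hsqrt]
  ring

variable {Ω : Type*} [MeasurableSpace Ω] {P : Measure Ω} {p : ℕ} {F : Measure (Fin p → ℝ)}

theorem memLp_four_of_integrable
    (hmom : ∀ a : Fin p → ℕ, ∑ i, a i = 4 → Integrable (fun x => ∏ i, |x i| ^ a i) F)
    (i : Fin p) : MemLp (fun x => x i) 4 F := by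
  have h := hmom (Pi.single i 4) (by simp)
  rw [← integrable_norm_rpow_iff (measurable_pi_apply i).aestronglyMeasurable
    (by norm_num) (by norm_num)]
  convert! h using 2 with x
  rw [Finset.prod_eq_single i (fun j _ hj => by simp [hj]) (by simp), Pi.single_eq_same,
    Real.norm_eq_abs, ENNReal.toReal_ofNat]
  exact Real.rpow_natCast _ 4

/-- The vector `x - m` together with its outer square `(x - m)(x - m)ᵀ`. Sample covariance
matrices are smooth functions of the sample means of these. -/
def centredMoments (m x : Fin p → ℝ) : (Fin p → ℝ) × (Fin p → Fin p → ℝ) :=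
  (x - m, fun i j => (x i - m i) * (x j - m j))

@[fun_prop]
theorem measurable_centredMoments (m : Fin p → ℝ) : Measurable (centredMoments m) := by
  unfold centredMoments
  fun_prop

theorem memLp_centredMoments [IsProbabilityMeasure F] (h : ∀ i, MemLp (fun x => x i) 4 F)
    (m : Fin p → ℝ) : MemLp (centredMoments m) 2 F := by
  have h4 (i : Fin p) : MemLp (fun x : Fin p → ℝ => x i - m i) 4 F := (h i).sub (memLp_const _)
  have : ENNReal.HolderTriple 4 4 2 := ⟨by
    rw [← ENNReal.toReal_eq_toReal_iff' (by simp) (by simp), ENNReal.toReal_add (by simp) (by simp)]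
    norm_num⟩
  refine memLp_prod_iff.2 ⟨memLp_pi_iff.2 fun i => ?_, memLp_pi_iff.2 fun i =>
    memLp_pi_iff.2 fun j => ?_⟩
  · exact (h4 i).mono_exponent (by norm_num)
  · exact (h4 j).mul' (h4 i)

theorem integral_centredMoments [IsProbabilityMeasure F] {m : Fin p → ℝ}
    (hm : ∀ i, ∫ x, x i ∂F = m i) (hint : Integrable (centredMoments m) F) :
    ∫ x, centredMoments m x ∂F = (0, fun i j => covarianceMatrix F i j) := by
  ext i j
  · have hi : Integrable (fun x : Fin p → ℝ => x i) F := by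
      simpa [centredMoments, Pi.add_def] using (hint.fst.eval i).add (integrable_const (m i))
    rw [fst_integral hint, eval_integral hint.fst.eval]
    simp [centredMoments, integral_sub hi, hm]
  · rw [snd_integral hint, eval_integral hint.snd.eval, eval_integral (hint.snd.eval i).eval]
    simp [centredMoments, covarianceMatrix, covariance, hm]

theorem aemeasurable_sampleCov {Y : ℕ → Ω → Fin p → ℝ} (hY : ∀ t, AEMeasurable (Y t) P)
    (c : SampleCovKind) (n : ℕ) :
    AEMeasurable (fun ω i j => sampleCov c n (fun t => Y t ω) i j : Ω → Fin p → Fin p → ℝ) P := by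
  have hY' (t : ℕ) (i : Fin p) : AEMeasurable (fun ω => Y t ω i) P :=
    (measurable_pi_apply i).comp_aemeasurable (hY t)
  refine aemeasurable_pi_iff.2 fun i => aemeasurable_pi_iff.2 fun j => ?_
  cases c <;> simp only [sampleCov, sampleMean, of_apply] <;> fun_prop

variable [IsProbabilityMeasure P] {Y : ℕ → Ω → Fin p → ℝ}

theorem asympNormal_mean_centredMoments (hindep : iIndepFun Y P) (hlaw : ∀ t, HasLaw (Y t) F P)
    (h : ∀ i, MemLp (fun x => x i) 4 F) {m : Fin p → ℝ} (hm : ∀ i, ∫ x, x i ∂F = m i) :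
    AsympNormal P (fun n ω => (n : ℝ)⁻¹ • ∑ t ∈ Finset.range n, centredMoments m (Y t ω))
      (0, fun i j => covarianceMatrix F i j) := by
  have hF : IsProbabilityMeasure F := (hlaw 0).isProbabilityMeasure_iff.1 inferInstance
  have hL2 : MemLp (centredMoments m) 2 F := memLp_centredMoments h m
  rw [← integral_centredMoments hm (hL2.integrable one_le_two),
    ← (hlaw 0).integral_comp hL2.aestronglyMeasurable]
  rw [← (hlaw 0).map_eq] at hL2
  exact asympNormal_mean (hindep.comp (fun _ => centredMoments m) fun _ => by fun_prop)
    (fun t => ((hlaw t).identDistrib (hlaw 0)).comp (measurable_centredMoments m))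
    (hL2.comp_of_map (hlaw 0).aemeasurable)

theorem asympNormal_sampleCov_aboutZero (hindep : iIndepFun Y P) (hlaw : ∀ t, HasLaw (Y t) F P)
    (h : ∀ i, MemLp (fun x => x i) 4 F) (hm : ∀ i, ∫ x, x i ∂F = 0) :
    AsympNormal P (fun n ω i j => sampleCov .aboutZero n (fun t => Y t ω) i j)
      (fun i j => covarianceMatrix F i j) := by
  have hY (t : ℕ) : AEMeasurable (Y t) P := (hlaw t).aemeasurable
  have hclt := (asympNormal_mean_centredMoments hindep hlaw h hm).comp_hasFDerivAt
    hasFDerivAt_snd fun n => by fun_prop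
  convert! hclt using 1
  ext n ω i j
  simp [sampleCov, centredMoments, Prod.snd_sum]

theorem asympNormal_sampleCov_aboutMean (hindep : iIndepFun Y P) (hlaw : ∀ t, HasLaw (Y t) F P)
    (h : ∀ i, MemLp (fun x => x i) 4 F) :
    AsympNormal P (fun n ω i j => sampleCov .aboutMean n (fun t => Y t ω) i j)
      (fun i j => covarianceMatrix F i j) := by
  have hY (t : ℕ) : AEMeasurable (Y t) P := (hlaw t).aemeasurable
  let g : (Fin p → ℝ) × (Fin p → Fin p → ℝ) → Fin p → Fin p → ℝ :=
    fun x i j => x.2 i j - x.1 i * x.1 j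
  have hg : Differentiable ℝ g := by fun_prop
  have hclt := (asympNormal_mean_centredMoments hindep hlaw h fun _ => rfl).comp_hasFDerivAt
    (hg _).hasFDerivAt fun n => hg.continuous.measurable.comp_aemeasurable (by fun_prop)
  convert! hclt using 1
  · ext n ω i j
    simp only [sampleCov, sampleMean, of_apply]
    rw [inv_mul_sum_sub_mean_mul_sub_mean n (fun t => Y t ω i) (fun t => Y t ω j)
      (∫ x, x i ∂F) (∫ x, x j ∂F)]
    simp [g, centredMoments, Prod.fst_sum, Prod.snd_sum]
  · ext i j
    simp [g]

theorem sampleCov_aboutMeanUnbiased (n : ℕ) (y : ℕ → Fin p → ℝ) :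
    sampleCov .aboutMeanUnbiased n y =
      (n * ((n : ℝ) - 1)⁻¹) • sampleCov .aboutMean n y := by
  ext i j
  rcases Nat.eq_zero_or_pos n with rfl | hn
  · simp [sampleCov]
  · simp only [sampleCov, Matrix.smul_apply, of_apply, smul_eq_mul]
    field_simp

theorem asympNormal_sampleCov (hindep : iIndepFun Y P) (hlaw : ∀ t, HasLaw (Y t) F P)
    (h : ∀ i, MemLp (fun x => x i) 4 F) (c : SampleCovKind)
    (hc : c = .aboutZero → ∀ i, ∫ x, x i ∂F = 0) :
    AsympNormal P (fun n ω i j => sampleCov c n (fun t => Y t ω) i j)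
      (fun i j => covarianceMatrix F i j) := by
  match c with
  | .aboutZero => exact asympNormal_sampleCov_aboutZero hindep hlaw h (hc rfl)
  | .aboutMean => exact asympNormal_sampleCov_aboutMean hindep hlaw h
  | .aboutMeanUnbiased =>
    simp only [sampleCov_aboutMeanUnbiased]
    exact (asympNormal_sampleCov_aboutMean hindep hlaw h).smul tendsto_sqrt_mul_bessel_sub_one

end SampleCovariance

section Estimator

variable {Ω : Type*} [MeasurableSpace Ω] {P : Measure Ω} [IsProbabilityMeasure P] {p : ℕ}

theorem asympNormal_ccaEstimator {H : SimpleGraph (Fin p)} {A : Matrix (Fin p) (Fin p) ℝ}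
    (hA : A ∈ posDefSpace H) {S : ℕ → Ω → Matrix (Fin p) (Fin p) ℝ}
    (hSm : ∀ n, AEMeasurable (fun ω i j => S n ω i j) P)
    (hS : AsympNormal P (fun n ω i j => S n ω i j) fun i j => A⁻¹ i j) :
    AsympNormal P (fun n ω i j => ccaEstimator H (S n ω) i j) fun i j => A i j := by
  let f : (Fin p → Fin p → ℝ) → Fin p → Fin p → ℝ := fun x i j => ccaEstimator H (of x) i j
  have hf : DifferentiableAt ℝ f fun i j => A⁻¹ i j :=
    differentiableAt_pi.2 fun i => differentiableAt_pi.2 fun j =>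
      differentiableAt_ccaEstimator (S := of) (fun _ _ => by simp only [of_apply]; fun_prop)
        hA.1.inv i j
  have hfm : Measurable f := measurable_pi_iff.2 fun i => measurable_pi_iff.2 fun j =>
    measurable_ccaEstimator (S := of) (fun _ _ => by simp only [of_apply]; fun_prop) i j
  convert! hS.comp_hasFDerivAt hf.hasFDerivAt fun n => hfm.comp_aemeasurable (hSm n) using 1
  ext i j
  exact congrFun₂ (ccaEstimator_inv_eq_self hA).symm i j

theorem BoundedInProbability.exists_measureReal_entry_le {X : ℕ → Ω → Fin p → Fin p → ℝ}
    (hX : BoundedInProbability P X) {ε : ℝ} (hε : 0 < ε) :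
    ∃ M : ℝ, ∀ n, P.real {ω | ∃ i j, M < |X n ω i j|} ≤ ε := by
  obtain ⟨M, hM⟩ := hX ε hε
  refine ⟨M, fun n => (measureReal_mono ?_).trans (hM n)⟩
  rintro ω ⟨i, j, hij⟩
  exact hij.trans_le ((norm_le_pi_norm (X n ω i) j).trans (norm_le_pi_norm (X n ω) i))

end Estimator

end CCA

theorem theoremS1 {V : Type*} {p : ℕ} (G : SimpleGraph V) (σ : V ≃ Fin p)
    {Ω : Type*} [MeasurableSpace Ω] (P : Measure Ω) [IsProbabilityMeasure P]
    (F : Measure (Fin p → ℝ)) (Y : ℕ → Ω → Fin p → ℝ)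
    (hindep : iIndepFun Y P) (hlaw : ∀ t, HasLaw (Y t) F P)
    (Ωbar : Matrix (Fin p) (Fin p) ℝ)
    (hΩ : Ωbar ∈ CCA.posDefSpace (CCA.orderedGraph G σ))
    (hcov : CCA.covarianceMatrix F = Ωbar⁻¹)
    (hmom : ∀ a : Fin p → ℕ, ∑ i, a i = 4 → Integrable (fun x => ∏ i, |x i| ^ a i) F)
    (c : CCA.SampleCovKind) (hc : c = .aboutZero → ∀ i, ∫ x, x i ∂F = 0)
    (Ωhat : ℕ → Ω → Matrix (Fin p) (Fin p) ℝ)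
    (hΩhat : ∀ n ω, Ωhat n ω =
      CCA.ccaEstimator (CCA.orderedGraph G σ) (CCA.sampleCov c n (fun t => Y t ω))) :
    (∀ ε : ℝ, 0 < ε → ∃ M : ℝ, ∀ n : ℕ,
      P.real {ω | ∃ i j, M < √(n : ℝ) * |Ωhat n ω i j - Ωbar i j|} ≤ ε) ∧
    ∃ (ν : Measure (Fin p → Fin p → ℝ)) (_ : IsGaussian ν),
      (∀ i j, ∫ A, A i j ∂ν = 0) ∧
      TendstoInDistribution (fun (n : ℕ) ω i j => √(n : ℝ) * (Ωhat n ω i j - Ωbar i j))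
        atTop id (fun _ => P) ν := by
  have hS := CCA.asympNormal_sampleCov hindep hlaw (CCA.memLp_four_of_integrable hmom) c hc
  rw [hcov] at hS
  have hnormal := CCA.asympNormal_ccaEstimator hΩ
    (CCA.aemeasurable_sampleCov (fun t => (hlaw t).aemeasurable) c) hS
  simp only [← hΩhat] at hnormal
  refine ⟨fun ε hε => ?_, ?_⟩
  · simpa [abs_mul, abs_of_nonneg] using
      hnormal.boundedInProbability.exists_measureReal_entry_le hε
  · obtain ⟨ν, hν, hmean, hlim⟩ := hnormal
    have hint : Integrable (fun A => A) ν := IsGaussian.integrable_id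
    refine ⟨ν, hν, fun i j => ?_, hlim⟩
    rw [← eval_integral (hint.eval i).eval, ← eval_integral hint.eval, hmean]
    rfl
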